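/- Let $q$ be an odd prime power and let $\mathbb F_q$ be the field with $q$ elements. For $f,g\in\mathbb F_q[X,Y]$, let $G_q(f,g)$ be the bipartite graph whose vertex set is the disjoint union of two copies $P$ and $L$ of $\mathbb F_q^3$, in which $(p_1,p_2,p_3)\in P$ and $[l_1,l_2,l_3]\in L$ are adjacent if and only if $$p_2+l_2=f(p_1,l_1)\quad\text{and}\quad p_3+l_3=g(p_1,l_1),$$ and there are no other edges. Suppose that $f$ and $g$ are monomials, that is, $f=aX^uY^v$ and $g=bX^sY^t$ with $a,b\in\mathbb F_q\setminus\{0\}$ and integers $u,v,s,t\ge 0$. If $G_q(f,g)$ has girth eight (its shortest cycle has length $8$), then $G_q(f,g)$ is isomorphic, as a graph, to $\Gamma_3(q)=G_q(XY,XY^2)$. -/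

import Mathlib

/-- The graph `G_q(f, g)` over a field `F` (with `q` elements). Its vertex set is the disjoint
union of two copies of `F³`, the points `(p₁, p₂, p₃)` (left summand) and the lines
`[l₁, l₂, l₃]` (right summand). A point and a line are adjacent if and only if
`p₂ + l₂ = f(p₁, l₁)` and `p₃ + l₃ = g(p₁, l₁)`, and there are no other edges.
The polynomial variables are `X = X 0` and `Y = X 1`. -/
def polyGraph {F : Type*} [Field F] (f g : MvPolynomial (Fin 2) F) :
    SimpleGraph ((F × F × F) ⊕ (F × F × F)) where
  Adj
    | Sum.inl (p₁, p₂, p₃), Sum.inr (l₁, l₂, l₃) =>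
        p₂ + l₂ = MvPolynomial.eval ![p₁, l₁] f ∧ p₃ + l₃ = MvPolynomial.eval ![p₁, l₁] g
    | Sum.inr (l₁, l₂, l₃), Sum.inl (p₁, p₂, p₃) =>
        p₂ + l₂ = MvPolynomial.eval ![p₁, l₁] f ∧ p₃ + l₃ = MvPolynomial.eval ![p₁, l₁] g
    | Sum.inl _, Sum.inl _ => False
    | Sum.inr _, Sum.inr _ => False
  symm := ⟨by rintro (⟨_, _, _⟩ | ⟨_, _, _⟩) (⟨_, _, _⟩ | ⟨_, _, _⟩) h <;> exact h⟩
  loopless := ⟨by rintro (⟨_, _, _⟩ | ⟨_, _, _⟩) h <;> exact h⟩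

/-- `f` is a monomial `a X^u Y^v` with `a ≠ 0` and arbitrary exponents `u, v ≥ 0`. -/
def IsMonomialPoly {F : Type*} [Field F] (f : MvPolynomial (Fin 2) F) : Prop :=
  ∃ (a : F) (u v : ℕ), a ≠ 0 ∧
    f = MvPolynomial.C a * MvPolynomial.X 0 ^ u * MvPolynomial.X 1 ^ v

/-- The graph `Γ₃(q) = G_q(XY, XY²)`. -/
noncomputable def gammaThree (F : Type*) [Field F] : SimpleGraph ((F × F × F) ⊕ (F × F × F)) :=
  polyGraph (MvPolynomial.X 0 * MvPolynomial.X 1) (MvPolynomial.X 0 * MvPolynomial.X 1 ^ 2)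

/-! ### Incidence graphs of function pairs and their short cycles -/

section IncidenceGraph

variable {F : Type*} [Field F]

/-! Scaling the last two coordinates removes the coefficients. Cycles of length 4 and 6 correspond
to closed sequences of first coordinates along which the alternating sums of both functions vanish.
Excluding 4-cycles, and in two mirror-image cases also 6-cycles, makes both power maps of one
monomial bijective, so that this monomial may be taken to be xy (`nonempty_iso_of_monomials`).

Let the other be x^s y^t. The absence of 6-cycles makes w ↦ ((a+w)^s - a^s)((b+m/w)^t - b^t)
injective on `Fˣ` (`injOn_of_eight_le_egirth`). This forces s and t to have opposite parity; after a
transposition s is odd, x^s is bijective, and y^t = 1 only for y = ±1. Frobenius on the third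
coordinate makes s prime to the characteristic p.

At a = b = 1 the injection misses one value c. Wilson's product gives c = -4((1-m/2)^s - 1), and the
first two power sums of the attained values are -c and -c² (`sum_units_eq`). Comparing coefficients
in m gives binomial identities that, read through base-p digits by Lucas' theorem, force s = 1
(`eq_one_of_choose_identities`). Then the slopes of y^t from each point are distinct, and Segre's
tangent argument gives y^t = y² on F (`pow_eq_sq_of_injective_slopes`). -/

/-- The bipartite graph on two copies of `F³` given by two arbitrary functions `f, g`. -/
def incidenceGraph (f g : F → F → F) : SimpleGraph ((F × F × F) ⊕ (F × F × F)) where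
  Adj
    | Sum.inl p, Sum.inr l => p.2.1 + l.2.1 = f p.1 l.1 ∧ p.2.2 + l.2.2 = g p.1 l.1
    | Sum.inr l, Sum.inl p => p.2.1 + l.2.1 = f p.1 l.1 ∧ p.2.2 + l.2.2 = g p.1 l.1
    | Sum.inl _, Sum.inl _ => False
    | Sum.inr _, Sum.inr _ => False
  symm := ⟨by rintro (_ | _) (_ | _) h <;> exact h⟩
  loopless := ⟨by rintro (_ | _) h <;> exact h⟩

theorem polyGraph_eq_incidenceGraph (f g : MvPolynomial (Fin 2) F) :
    polyGraph f g = incidenceGraph (fun x y => MvPolynomial.eval ![x, y] f)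
      (fun x y => MvPolynomial.eval ![x, y] g) := by
  ext v w
  rcases v with ⟨_, _, _⟩ | ⟨_, _, _⟩ <;> rcases w with ⟨_, _, _⟩ | ⟨_, _, _⟩ <;> rfl

/-- Exchanging the two defining functions. -/
def incidenceGraphSwap (f g : F → F → F) : incidenceGraph f g ≃g incidenceGraph g f where
  toEquiv := Equiv.sumCongr ((Equiv.refl F).prodCongr (Equiv.prodComm F F))
    ((Equiv.refl F).prodCongr (Equiv.prodComm F F))
  map_rel_iff' := by
    rintro (_ | _) (_ | _) <;> simp [incidenceGraph, and_comm]

/-- Exchanging points and lines. -/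
def incidenceGraphTranspose (f g : F → F → F) :
    incidenceGraph f g ≃g incidenceGraph (fun x y => f y x) (fun x y => g y x) where
  toEquiv := Equiv.sumComm _ _
  map_rel_iff' := by
    rintro (_ | _) (_ | _) <;> simp [incidenceGraph, add_comm]

/-- Reparametrising the first coordinates by bijections and the others by additive bijections. -/
def incidenceGraphCongr {f g f' g' : F → F → F} (σ τ : F ≃ F) (α β : F ≃+ F)
    (hf : ∀ x y, f' (σ x) (τ y) = α (f x y)) (hg : ∀ x y, g' (σ x) (τ y) = β (g x y)) :
    incidenceGraph f g ≃g incidenceGraph f' g' where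
  toEquiv := Equiv.sumCongr (σ.prodCongr (α.toEquiv.prodCongr β.toEquiv))
    (τ.prodCongr (α.toEquiv.prodCongr β.toEquiv))
  map_rel_iff' := by
    rintro (_ | _) (_ | _) <;> simp [incidenceGraph, hf, hg, ← map_add]

/-- Three of the four edges can be realised with `l₁` based at zero; the vanishing alternating sums
are what closes the fourth. -/
theorem not_quadrangle {f g : F → F → F} (h : 8 ≤ (incidenceGraph f g).egirth)
    {x x' y y' : F} (hx : x ≠ x') (hy : y ≠ y')
    (hf : f x y - f x' y + f x' y' - f x y' = 0)
    (hg : g x y - g x' y + g x' y' - g x y' = 0) : False := by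
  let G := incidenceGraph f g
  let p₁ : F × F × F := (x, f x y, g x y)
  let p₂ : F × F × F := (x', f x' y, g x' y)
  let l₁ : F × F × F := (y, 0, 0)
  let l₂ : F × F × F := (y', f x' y' - f x' y, g x' y' - g x' y)
  have h1 : G.Adj (Sum.inl p₁) (Sum.inr l₁) := by simp [G, incidenceGraph, p₁, l₁]
  have h2 : G.Adj (Sum.inr l₁) (Sum.inl p₂) := by simp [G, incidenceGraph, p₂, l₁]
  have h3 : G.Adj (Sum.inl p₂) (Sum.inr l₂) := by simp [G, incidenceGraph, p₂, l₂]
  have h4 : G.Adj (Sum.inr l₂) (Sum.inl p₁) := by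
    constructor
    · linear_combination hf
    · linear_combination hg
  let w : G.Walk (Sum.inl p₁) (Sum.inl p₁) :=
    .cons h1 (.cons h2 (.cons h3 (.cons h4 .nil)))
  have hw : w.IsCycle := by
    simp [w, SimpleGraph.Walk.cons_isCycle_iff, SimpleGraph.Walk.isPath_def, p₁, p₂, l₁, l₂,
      hx, hx.symm, hy]
  have := SimpleGraph.le_egirth.1 h _ w hw
  exact absurd this (by simp [w]; decide)

theorem not_hexagon {f g : F → F → F} (h : 8 ≤ (incidenceGraph f g).egirth)
    {x₁ x₂ x₃ y₁ y₂ y₃ : F} (hx₁₂ : x₁ ≠ x₂) (hx₂₃ : x₂ ≠ x₃) (hx₁₃ : x₁ ≠ x₃)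
    (hy₁₂ : y₁ ≠ y₂) (hy₂₃ : y₂ ≠ y₃) (hy₁₃ : y₁ ≠ y₃)
    (hf : f x₁ y₁ - f x₂ y₁ + f x₂ y₂ - f x₃ y₂ + f x₃ y₃ - f x₁ y₃ = 0)
    (hg : g x₁ y₁ - g x₂ y₁ + g x₂ y₂ - g x₃ y₂ + g x₃ y₃ - g x₁ y₃ = 0) : False := by
  let G := incidenceGraph f g
  let p₁ : F × F × F := (x₁, f x₁ y₁, g x₁ y₁)
  let p₂ : F × F × F := (x₂, f x₂ y₁, g x₂ y₁)
  let l₁ : F × F × F := (y₁, 0, 0)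
  let l₂ : F × F × F := (y₂, f x₂ y₂ - f x₂ y₁, g x₂ y₂ - g x₂ y₁)
  let p₃ : F × F × F := (x₃, f x₃ y₂ - (f x₂ y₂ - f x₂ y₁), g x₃ y₂ - (g x₂ y₂ - g x₂ y₁))
  let l₃ : F × F × F := (y₃, f x₁ y₃ - f x₁ y₁, g x₁ y₃ - g x₁ y₁)
  have h1 : G.Adj (Sum.inl p₁) (Sum.inr l₁) := by simp [G, incidenceGraph, p₁, l₁]
  have h2 : G.Adj (Sum.inr l₁) (Sum.inl p₂) := by simp [G, incidenceGraph, p₂, l₁]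
  have h3 : G.Adj (Sum.inl p₂) (Sum.inr l₂) := by simp [G, incidenceGraph, p₂, l₂]
  have h4 : G.Adj (Sum.inr l₂) (Sum.inl p₃) := by simp [G, incidenceGraph, p₃, l₂]
  have h5 : G.Adj (Sum.inl p₃) (Sum.inr l₃) := by
    constructor
    · linear_combination -hf
    · linear_combination -hg
  have h6 : G.Adj (Sum.inr l₃) (Sum.inl p₁) := by simp [G, incidenceGraph, p₁, l₃]
  let w : G.Walk (Sum.inl p₁) (Sum.inl p₁) :=
    .cons h1 (.cons h2 (.cons h3 (.cons h4 (.cons h5 (.cons h6 .nil)))))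
  have hw : w.IsCycle := by
    simp [w, SimpleGraph.Walk.cons_isCycle_iff, SimpleGraph.Walk.isPath_def, p₁, p₂, p₃, l₁, l₂,
      l₃, hx₁₂, hx₁₂.symm, hx₁₃, hx₁₃.symm, hx₂₃, hy₁₂, hy₁₃, hy₂₃]
  have := SimpleGraph.le_egirth.1 h _ w hw
  exact absurd this (by simp [w]; decide)

/-- Without hexagons, the lines reached from a point by paths of length three are distinct. -/
theorem injOn_of_eight_le_egirth {s t : ℕ}
    (h : 8 ≤ (incidenceGraph (F := F) (fun x y => x * y) (fun x y => x ^ s * y ^ t)).egirth)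
    (a b : F) {m : F} (hm : m ≠ 0) {w w' : F} (hw : w ≠ 0) (hw' : w' ≠ 0)
    (he : ((a + w) ^ s - a ^ s) * ((b + m / w) ^ t - b ^ t) =
      ((a + w') ^ s - a ^ s) * ((b + m / w') ^ t - b ^ t)) : w = w' := by
  by_contra hne
  have hd : m / w ≠ m / w' := fun e => hne (by field_simp at e; exact e.symm)
  have e1 : w * (m / w) = m := by field_simp
  have e2 : w' * (m / w') = m := by field_simp
  -- The alternating sum of xy around this hexagon is w'(m/w') - w(m/w) = 0, so only the second
  -- function gives a condition.
  refine not_hexagon h (x₁ := a) (x₂ := a + w) (x₃ := a + w') (y₁ := b + m / w) (y₂ := b)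
    (y₃ := b + m / w') ?_ ?_ ?_ ?_ ?_ ?_ ?_ ?_
  · simpa using hw
  · simpa using hne
  · simpa using hw'
  · simpa using ⟨hm, hw⟩
  · simpa using ⟨hm, hw'⟩
  · simpa using hd
  · linear_combination e2 - e1
  · linear_combination -he

end IncidenceGraph

/-- The function equal to the identity away from zero, and to `1` at zero. -/
def oneAtZero {F : Type*} [Field F] [DecidableEq F] (x : F) : F := if x = 0 then 1 else x

theorem oneAtZero_of_ne {F : Type*} [Field F] [DecidableEq F] {x : F} (h : x ≠ 0) : oneAtZero x = x := if_neg h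

theorem oneAtZero_zero {F : Type*} [Field F] [DecidableEq F] : oneAtZero (0 : F) = 1 := if_pos rfl

theorem pow_injective_of_pow_eq_one {F : Type*} [Field F] {k : ℕ} (hk : k ≠ 0) (h : ∀ z : F, z ^ k = 1 → z = 1) :
    Function.Injective fun z : F => z ^ k := by
  intro x y hxy
  simp only at hxy
  by_cases hy : y = 0
  · subst hy
    rw [zero_pow hk] at hxy
    exact (pow_eq_zero_iff hk).1 hxy
  · have := h (x / y) (by rw [div_pow, hxy, div_self (pow_ne_zero _ hy)])
    rwa [div_eq_one_iff_eq hy] at this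

/-! ### Wilson products and power sums over a finite field -/

section FiniteFieldSums

open Polynomial

variable {F : Type*} [Field F] [Fintype F] [DecidableEq F]

/-- An injective function from `Fˣ` to `F` misses exactly one value. -/
theorem exists_missing_value {W : Fˣ → F} (hW : Function.Injective W) :
    ∃ c, (∀ w, W w ≠ c) ∧ (∀ φ : F → F, ∑ w, φ (W w) + φ c = ∑ x, φ x) ∧
      ∀ φ : F → F, (∏ w, φ (W w)) * φ c = ∏ x, φ x := by
  have h1 : (Finset.univ.image W)ᶜ.card = 1 := by
    rw [Finset.card_compl, Finset.card_image_of_injective _ hW, Finset.card_univ,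
      Fintype.card_units]
    have := Fintype.card_pos (α := F)
    omega
  obtain ⟨c, hc⟩ := Finset.card_eq_one.1 h1
  refine ⟨c, fun w hw => ?_, fun φ => ?_, fun φ => ?_⟩
  · have : c ∈ (Finset.univ.image W)ᶜ := by simp [hc]
    simp [hw ▸ Finset.mem_image_of_mem W (Finset.mem_univ w)] at this
  · rw [← Finset.sum_add_sum_compl (Finset.univ.image W), hc, Finset.sum_singleton,
      Finset.sum_image fun _ _ _ _ h => hW h]
  · rw [← Finset.prod_mul_prod_compl (Finset.univ.image W), hc, Finset.prod_singleton,
      Finset.prod_image fun _ _ _ _ h => hW h]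

theorem prod_units_mul_zero (φ : F → F) : (∏ w : Fˣ, φ w) * φ 0 = ∏ x, φ x := by
  obtain ⟨c, hc, -, h⟩ := exists_missing_value (F := F) (W := fun w => (w : F)) Units.val_injective
  have : c = 0 := by
    by_contra h0
    exact hc (Units.mk0 c h0) rfl
  rw [← h, this]

theorem prod_units_val : ∏ w : Fˣ, (w : F) = -1 := by
  have := congrArg (Units.val) (FiniteField.prod_univ_units_id_eq_neg_one (K := F))
  simpa using this

theorem prod_oneAtZero : ∏ x : F, oneAtZero x = -1 := by
  rw [← prod_units_mul_zero, oneAtZero_zero, mul_one, ← prod_units_val]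
  exact Finset.prod_congr rfl fun w _ => oneAtZero_of_ne w.ne_zero

theorem prod_oneAtZero_sub (c : F) : ∏ x : F, oneAtZero (x - c) = -1 := by
  rw [← prod_oneAtZero]
  exact Fintype.prod_equiv (Equiv.subRight c) _ _ fun _ => rfl

/-- Factor z² - 1 as (z-1)(z+1): each factor has regularised product -1, while the surviving factors
at z = 1 and z = -1 are 2 and -2. -/
theorem four_mul_prod_sq_sub_one (h2 : (2 : F) ≠ 0) :
    4 * ∏ z : F, oneAtZero (z ^ 2 - 1) = -1 := by
  have key : ∀ z : F, oneAtZero (z - 1) * oneAtZero (z - -1) =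
      oneAtZero (z ^ 2 - 1) * (if z = 1 then 2 else 1) * (if z = -1 then -2 else 1) := by
    intro z
    have h11 : (1 : F) ≠ -1 := fun h => h2 (by linear_combination h)
    by_cases h1 : z = 1
    · subst h1
      rw [if_pos rfl, if_neg h11, sub_self, one_pow, sub_self, oneAtZero_zero, oneAtZero_of_ne] <;>
      · ring_nf
        try exact h2
    by_cases h3 : z = -1
    · subst h3
      have : (-1 - 1 : F) ≠ 0 := fun h => h2 (by linear_combination -h)
      rw [if_pos rfl, if_neg h11.symm, sub_self, neg_one_sq, sub_self, oneAtZero_zero,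
        oneAtZero_of_ne this]
      ring
    · rw [if_neg h1, if_neg h3, mul_one, mul_one]
      have e1 : z - 1 ≠ 0 := sub_ne_zero.2 h1
      have e2 : z - -1 ≠ 0 := sub_ne_zero.2 h3
      have e3 : z ^ 2 - 1 = (z - 1) * (z - -1) := by ring
      rw [e3, oneAtZero_of_ne e1, oneAtZero_of_ne e2, oneAtZero_of_ne (mul_ne_zero e1 e2)]
  have := Finset.prod_congr rfl fun z (_ : z ∈ (Finset.univ : Finset F)) => key z
  rw [Finset.prod_mul_distrib, Finset.prod_mul_distrib, Finset.prod_mul_distrib,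
    prod_oneAtZero_sub, prod_oneAtZero_sub, Finset.prod_ite_eq' Finset.univ,
    Finset.prod_ite_eq' Finset.univ, if_pos (Finset.mem_univ _), if_pos (Finset.mem_univ _)] at this
  linear_combination this

/-- If `±1` are the only roots of unity of even order `t`, then `z ^ t` runs through the values
of `z ^ 2`. -/
theorem exists_bijective_sq_eq_pow (h2 : (2 : F) ≠ 0) {t : ℕ} (ht : Even t)
    (ht0 : t ≠ 0) (hroot : ∀ z : F, z ^ t = 1 → z = 1 ∨ z = -1) :
    ∃ σ : F → F, Function.Bijective σ ∧ ∀ z, σ z ^ 2 = z ^ t := by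
  have hodd : ∃ τ : ℕ, Odd τ ∧ ∀ z : F, (z ^ τ) ^ 2 = z ^ t := by
    obtain ⟨t', rfl⟩ := ht
    rcases Nat.even_or_odd t' with h | h
    -- A square root of -1 would be a forbidden root of unity, so (q-1)/2 is odd. Adding it to t/2
    -- makes the exponent odd and changes its double only by q-1.
    · have hq : Fintype.card F % 4 = 3 := by
        by_contra hq
        obtain ⟨i, hi⟩ := FiniteField.isSquare_neg_one_iff.2 hq
        obtain ⟨k, rfl⟩ := h
        have : i ^ (k + k + (k + k)) = 1 := by
          have : i ^ (k + k + (k + k)) = ((i * i) ^ 2) ^ k := by ring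
          rw [this, ← hi]; simp
        rcases hroot i this with rfl | rfl
        · exact h2 (by linear_combination -hi)
        · exact h2 (by linear_combination -hi)
      refine ⟨t' + (Fintype.card F - 1) / 2, ?_, fun z => ?_⟩
      · exact h.add_odd (Nat.odd_iff.2 (by omega))
      · by_cases hz : z = 0
        · subst hz
          have : t' ≠ 0 := by omega
          rw [zero_pow (by omega), zero_pow (by omega), zero_pow (by omega)]
        · have e : (t' + (Fintype.card F - 1) / 2) * 2 = (t' + t') + (Fintype.card F - 1) := by
            omega
          rw [← pow_mul, e, pow_add, FiniteField.pow_card_sub_one_eq_one z hz, mul_one]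
    · exact ⟨t', h, fun z => by rw [← pow_mul, mul_two]⟩
  obtain ⟨τ, hτ, hz⟩ := hodd
  refine ⟨fun z => z ^ τ, Finite.injective_iff_bijective.1 ?_, hz⟩
  refine pow_injective_of_pow_eq_one hτ.pos.ne' fun z h => ?_
  rcases hroot z (by rw [← hz, h, one_pow]) with h' | h'
  · exact h'
  · rw [h', hτ.neg_one_pow] at h
    exact absurd (by linear_combination -h) h2

theorem four_mul_prod_pow_sub_one (h2 : (2 : F) ≠ 0) {t : ℕ} (ht : Even t)
    (ht0 : t ≠ 0) (hroot : ∀ z : F, z ^ t = 1 → z = 1 ∨ z = -1) :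
    4 * ∏ z : F, oneAtZero (z ^ t - 1) = -1 := by
  obtain ⟨σ, hσ, hz⟩ := exists_bijective_sq_eq_pow h2 ht ht0 hroot
  rw [← four_mul_prod_sq_sub_one h2]
  congr 1
  exact Fintype.prod_bijective σ hσ _ _ fun z => by rw [hz]

theorem sum_units_pow (i : ℕ) :
    ∑ w : Fˣ, (w : F) ^ i = if Fintype.card F - 1 ∣ i then -1 else 0 := by
  rw [← FiniteField.sum_pow_units]

/-- Multiplicative convolution of two polynomial functions. -/
theorem sum_units_eval_mul_eval_div {A B : F[X]} (hA : A.natDegree < Fintype.card F - 1)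
    (hB : B.natDegree < 2 * (Fintype.card F - 1)) {m : F} :
    ∑ w : Fˣ, A.eval (w : F) * B.eval (m / w) =
      -∑ i ∈ Finset.range (Fintype.card F - 1),
        A.coeff i * (B.coeff i * m ^ i +
          B.coeff (i + (Fintype.card F - 1)) * m ^ (i + (Fintype.card F - 1))) := by
  set n := Fintype.card F - 1 with hn
  -- The period 2n, rather than n, keeps the exponent a natural number for every j below the degree
  -- bound of B.
  have hinv : ∀ (w : Fˣ) (j : ℕ), j < 2 * n → (m / (w : F)) ^ j = m ^ j * (w : F) ^ (2 * n - j) := by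
    intro w j hj
    have h1 : (w : F) ^ (2 * n) = 1 := by
      rw [mul_comm, pow_mul, FiniteField.pow_card_sub_one_eq_one _ w.ne_zero, one_pow]
    have h3 : (w : F) ^ j * (w : F) ^ (2 * n - j) = 1 := by
      rw [← pow_add, Nat.add_sub_cancel' hj.le, h1]
    rw [div_pow, div_eq_iff (pow_ne_zero _ w.ne_zero)]
    linear_combination -m ^ j * h3
  have h1 : ∀ w : Fˣ, A.eval (w : F) * B.eval (m / w) =
      ∑ i ∈ Finset.range n, ∑ j ∈ Finset.range (2 * n),
        A.coeff i * (B.coeff j * m ^ j) * (w : F) ^ (i + (2 * n - j)) := by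
    intro w
    rw [eval_eq_sum_range' hA, eval_eq_sum_range' hB, Finset.sum_mul_sum]
    refine Finset.sum_congr rfl fun i _ => Finset.sum_congr rfl fun j hj => ?_
    rw [hinv w j (Finset.mem_range.1 hj), pow_add]
    ring
  simp_rw [h1]
  rw [Finset.sum_comm, ← Finset.sum_neg_distrib]
  refine Finset.sum_congr rfl fun i hi => ?_
  have hi := Finset.mem_range.1 hi
  rw [Finset.sum_comm]
  -- The sum over w survives only if n divides i + 2n - j, that is, for j = i or j = i + n.
  have h2 : ∀ j ∈ Finset.range (2 * n), (∑ w : Fˣ, A.coeff i * (B.coeff j * m ^ j) *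
      (w : F) ^ (i + (2 * n - j))) = (if j = i then -(A.coeff i * (B.coeff j * m ^ j)) else 0) +
      (if j = i + n then -(A.coeff i * (B.coeff j * m ^ j)) else 0) := by
    intro j hj
    have hj := Finset.mem_range.1 hj
    rw [← Finset.mul_sum, sum_units_pow, ← hn]
    by_cases hji : j = i
    · have : i + (2 * n - j) = 2 * n := by omega
      rw [this, if_pos (Dvd.intro_left 2 rfl), if_pos hji, if_neg (by omega)]
      ring
    by_cases hji' : j = i + n
    · have : i + (2 * n - j) = n := by omega
      rw [this, if_pos dvd_rfl, if_neg hji, if_pos hji']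
      ring
    · rw [if_neg, if_neg hji, if_neg hji']
      · ring
      rintro ⟨k, hk⟩
      have hk3 : k < 3 := by
        by_contra hk3
        have := Nat.mul_le_mul_left n (not_lt.1 hk3)
        omega
      interval_cases k <;> omega
  rw [Finset.sum_congr rfl h2, Finset.sum_add_distrib, Finset.sum_ite_eq' , Finset.sum_ite_eq',
    if_pos (Finset.mem_range.2 (by omega)), if_pos (Finset.mem_range.2 (by omega))]
  ring

/-- Polynomial expressions of degree less than `q - 1` are determined by their values on `Fˣ`. -/
theorem coeff_eq_of_sum_eq {a b : ℕ → F}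
    (h : ∀ m : F, m ≠ 0 → ∑ i ∈ Finset.range (Fintype.card F - 1), a i * m ^ i =
      ∑ i ∈ Finset.range (Fintype.card F - 1), b i * m ^ i) {i : ℕ}
    (hi : i < Fintype.card F - 1) : a i = b i := by
  set n := Fintype.card F - 1 with hn
  have hco : ∀ c : ℕ → F, (∑ j ∈ Finset.range n, monomial j (c j)).coeff i = c i := by
    intro c
    rw [finsetSum_coeff]
    simp [coeff_monomial, hi]
  have hdeg : ∀ c : ℕ → F, (∑ j ∈ Finset.range n, monomial j (c j)).degree < n := by
    intro c
    refine (degree_sum_le _ _).trans_lt ((Finset.sup_lt_iff (WithBot.bot_lt_coe n)).2 ?_)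
    intro j hj
    exact (degree_monomial_le _ _).trans_lt (WithBot.coe_lt_coe.2 (Finset.mem_range.1 hj))
  have heq : ∑ j ∈ Finset.range n, monomial j (a j) = ∑ j ∈ Finset.range n, monomial j (b j) := by
    refine eq_of_degrees_lt_of_eval_finset_eq (Finset.univ.erase (0 : F)) ?_ ?_ ?_
    · rw [Finset.card_erase_of_mem (Finset.mem_univ _), Finset.card_univ]
      exact hdeg a
    · rw [Finset.card_erase_of_mem (Finset.mem_univ _), Finset.card_univ]
      exact hdeg b
    · intro m hm
      simpa [eval_finsetSum] using h m (Finset.ne_of_mem_erase hm)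
  rw [← hco a, heq, hco b]

end FiniteFieldSums

/-! ### Lucas' theorem for splitting at a prime power -/

section Lucas

theorem choose_modEq_choose_mod_pow_mul_choose_div_pow {p : ℕ} [Fact p.Prime] (a n k : ℕ) :
    n.choose k ≡ (n % p ^ a).choose (k % p ^ a) * (n / p ^ a).choose (k / p ^ a) [MOD p] := by
  induction a generalizing n k with
  | zero => simp [Nat.mod_one]; rfl
  | succ a ih =>
    have h1 : ∀ x : ℕ, x % p ^ (a + 1) % p ^ a = x % p ^ a := fun x =>
      Nat.mod_mod_of_dvd x (pow_dvd_pow p (Nat.le_succ a))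
    have h2 : ∀ x : ℕ, x % p ^ (a + 1) / p ^ a = x / p ^ a % p := fun x => by
      rw [pow_succ, Nat.mod_mul_right_div_self]
    have h3 : ∀ x : ℕ, x / p ^ (a + 1) = x / p ^ a / p := fun x => by
      rw [pow_succ, Nat.div_div_eq_div_mul]
    have e1 := ih n k
    have e2 := ih (n % p ^ (a + 1)) (k % p ^ (a + 1))
    rw [h1, h1, h2, h2] at e2
    have e3 := Choose.choose_modEq_choose_mod_mul_choose_div_nat (p := p) (n := n / p ^ a)
      (k := k / p ^ a)
    rw [h3, h3]
    calc _ ≡ _ [MOD p] := e1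
      _ ≡ _ [MOD p] := Nat.ModEq.mul_left _ e3
      _ = (n % p ^ a).choose (k % p ^ a) * (n / p ^ a % p).choose (k / p ^ a % p) *
          (n / p ^ a / p).choose (k / p ^ a / p) := by ring
      _ ≡ _ [MOD p] := Nat.ModEq.mul_right _ e2.symm

/-- Lucas' theorem at a power of the characteristic. -/
theorem cast_choose_eq_mod_pow_mul_div_pow (R : Type*) [CommRing R] {p : ℕ} [Fact p.Prime]
    [CharP R p] (a n k : ℕ) :
    (n.choose k : R) = (n % p ^ a).choose (k % p ^ a) * (n / p ^ a).choose (k / p ^ a) := by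
  rw [← Nat.cast_mul, CharP.natCast_eq_natCast R p]
  exact choose_modEq_choose_mod_pow_mul_choose_div_pow a n k

end Lucas

/-! ### From the missing value to binomial identities -/

section CoefficientIdentities

open Polynomial

theorem coeff_one_add_X_pow_sub_one {R : Type*} [CommRing R] (s : ℕ) {i : ℕ} (hi : i ≠ 0) :
    ((1 + X : R[X]) ^ s - 1).coeff i = s.choose i := by
  rw [coeff_sub, coeff_one_add_X_pow, coeff_one, if_neg hi, sub_zero]

theorem coeff_sq_one_add_X_pow_sub_one {R : Type*} [CommRing R] (s : ℕ) {i : ℕ} (hi : i ≠ 0) :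
    (((1 + X : R[X]) ^ s - 1) ^ 2).coeff i =
      ((2 * s).choose i : R) - 2 * (s.choose i : R) := by
  have : ((1 + X : R[X]) ^ s - 1) ^ 2 =
      (1 + X) ^ (2 * s) - (((1 + X) ^ s - 1) + ((1 + X) ^ s - 1)) - 1 := by
    ring
  rw [this, coeff_sub, coeff_sub, coeff_add, coeff_one_add_X_pow_sub_one s hi,
    coeff_one_add_X_pow, coeff_one, if_neg hi]
  ring

theorem natDegree_one_add_X_pow_sub_one_le {R : Type*} [CommRing R] (s : ℕ) :
    ((1 + X : R[X]) ^ s - 1).natDegree ≤ s := by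
  compute_degree

theorem natDegree_sq_one_add_X_pow_sub_one_le {R : Type*} [CommRing R] (s : ℕ) :
    (((1 + X : R[X]) ^ s - 1) ^ 2).natDegree ≤ 2 * s :=
  natDegree_pow_le_of_le 2 (natDegree_one_add_X_pow_sub_one_le s)

variable {F : Type*} [Field F] [Fintype F] [DecidableEq F]

/-- Compare coefficients of m^i; as m^(q-1) = 1, the coefficient of B in degree i + q - 1 folds onto
degree i. -/
theorem coeff_mul_coeff_eq {A B : F[X]} (hA : A.natDegree < Fintype.card F - 1)
    (hB : B.natDegree < 2 * (Fintype.card F - 1)) {κ r : F}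
    (h : ∀ m : F, m ≠ 0 → ∑ w : Fˣ, A.eval (w : F) * B.eval (m / w) = -(κ * A.eval (r * m)))
    {i : ℕ} (hi : i < Fintype.card F - 1) :
    A.coeff i * (B.coeff i + B.coeff (i + (Fintype.card F - 1))) = κ * r ^ i * A.coeff i := by
  refine coeff_eq_of_sum_eq
    (a := fun i => A.coeff i * (B.coeff i + B.coeff (i + (Fintype.card F - 1))))
    (b := fun i => κ * r ^ i * A.coeff i) (fun m hm => ?_) hi
  have h1 := h m hm
  rw [sum_units_eval_mul_eval_div hA hB, eval_eq_sum_range' hA, neg_inj, Finset.mul_sum] at h1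
  convert h1 using 2
  · rw [pow_add, FiniteField.pow_card_sub_one_eq_one m hm]
    ring
  · ring

theorem prod_oneAtZero_one_add_pow_sub_one (s : ℕ) :
    ∏ w : Fˣ, oneAtZero ((1 + (w : F)) ^ s - 1) = ∏ z : F, oneAtZero (z ^ s - 1) := by
  have h := prod_units_mul_zero (F := F) fun x => oneAtZero ((1 + x) ^ s - 1)
  simp only [add_zero, one_pow, sub_self, oneAtZero_zero, mul_one] at h
  rw [h]
  exact Fintype.prod_equiv (Equiv.addLeft 1) _ _ fun _ => rfl

/-- The value missed by a hexagon-free family of products, and its first two power sums. -/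
theorem sum_units_eq {s t : ℕ} (h2 : (2 : F) ≠ 0) (hcard : 2 < Fintype.card F - 1) (hs0 : s ≠ 0)
    (hs : ∀ z : F, z ^ s = 1 → z = 1) (ht : Even t) (ht0 : t ≠ 0)
    (hroot : ∀ z : F, z ^ t = 1 → z = 1 ∨ z = -1) {m : F} (hm : m ≠ 0)
    (hinj : Function.Injective fun w : Fˣ => ((1 + (w : F)) ^ s - 1) * ((1 + m / w) ^ t - 1)) :
    ∑ w : Fˣ, ((1 + (w : F)) ^ s - 1) * ((1 + m / w) ^ t - 1) =
        4 * ((1 + -1 / 2 * m) ^ s - 1) ∧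
      ∑ w : Fˣ, (((1 + (w : F)) ^ s - 1) * ((1 + m / w) ^ t - 1)) ^ 2 =
        -(16 * ((1 + -1 / 2 * m) ^ s - 1) ^ 2) := by
  obtain ⟨c, hc, hsum, hprod⟩ := exists_missing_value hinj
  have hκ := four_mul_prod_pow_sub_one h2 ht ht0 hroot
  set κ := ∏ z : F, oneAtZero (z ^ t - 1)
  -- The only w with 1 + m/w = -1, hence the only zero of the product.
  set u : Fˣ := Units.mk0 (-1 / 2 * m)
    (mul_ne_zero (div_ne_zero (neg_ne_zero.2 one_ne_zero) h2) hm) with hu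
  have huv : (u : F) = -1 / 2 * m := rfl
  have hP : ∀ w : Fˣ, (1 + (w : F)) ^ s - 1 ≠ 0 := fun w h => by
    have := hs _ (sub_eq_zero.1 h)
    exact w.ne_zero (by linear_combination this)
  have hQ : ∀ w : Fˣ, (1 + m / w) ^ t - 1 = 0 ↔ w = u := by
    intro w
    constructor
    · intro h
      have hmw : m / w * w = m := div_mul_cancel₀ _ w.ne_zero
      rcases hroot _ (sub_eq_zero.1 h) with h' | h'
      · exact absurd (by linear_combination h') (div_ne_zero hm w.ne_zero)
      · refine Units.ext ?_
        rw [huv, ← hmw]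
        field_simp
        have : m / w = -2 := by linear_combination h'
        rw [div_eq_iff w.ne_zero] at this
        rw [this]
        ring
    · rintro rfl
      have : 1 + m / (u : F) = -1 := by
        rw [huv]; field_simp; ring
      rw [this, ht.neg_one_pow, sub_self]
  have hc0 : c ≠ 0 := by
    rintro rfl
    refine hc u ?_
    rw [(hQ u).2 rfl, mul_zero]
  -- `oneAtZero` is multiplicative except at w = u, where the first factor is lost and must be put
  -- back.
  have hsplit : ∀ w : Fˣ, oneAtZero (((1 + (w : F)) ^ s - 1) * ((1 + m / w) ^ t - 1)) *
      (if w = u then (1 + (u : F)) ^ s - 1 else 1) =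
      oneAtZero ((1 + (w : F)) ^ s - 1) * oneAtZero ((1 + m / w) ^ t - 1) := by
    intro w
    by_cases hw : w = u
    · rw [if_pos hw, (hQ w).2 hw, mul_zero, oneAtZero_zero, one_mul, mul_one,
        oneAtZero_of_ne (hP w), hw]
    · have hw' := (hQ w).not.2 hw
      rw [if_neg hw, oneAtZero_of_ne (hP w), oneAtZero_of_ne hw',
        oneAtZero_of_ne (mul_ne_zero (hP w) hw'), mul_one]
  have e1 : ∏ w : Fˣ, oneAtZero ((1 + (w : F)) ^ s - 1) = -1 := by
    rw [prod_oneAtZero_one_add_pow_sub_one, ← prod_oneAtZero_sub 1]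
    exact Fintype.prod_bijective _ (Finite.injective_iff_bijective.1
      (pow_injective_of_pow_eq_one hs0 hs)) _ _ fun _ => rfl
  have e2 : ∏ w : Fˣ, oneAtZero ((1 + m / (w : F)) ^ t - 1) = κ := by
    rw [show κ = _ from (prod_oneAtZero_one_add_pow_sub_one t).symm]
    exact Fintype.prod_equiv (Equiv.divLeft (Units.mk0 m hm)) _ _ fun w => by simp
  have e3 := Finset.prod_congr rfl fun w (_ : w ∈ (Finset.univ : Finset Fˣ)) => hsplit w
  rw [Finset.prod_mul_distrib, Finset.prod_mul_distrib, e1, e2, Finset.prod_ite_eq',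
    if_pos (Finset.mem_univ _), huv] at e3
  have e4 := hprod oneAtZero
  rw [oneAtZero_of_ne hc0, prod_oneAtZero] at e4
  have hcval : c = -(4 * ((1 + -1 / 2 * m) ^ s - 1)) := by
    linear_combination 4 * ((1 + -1 / 2 * m) ^ s - 1) * e4 - 4 * c * e3 + c * hκ
  have s1 := hsum fun x => x ^ 1
  have s2 := hsum fun x => x ^ 2
  -- Both exponents are below q - 1, so the power sums over F vanish and only the missing value
  -- contributes.
  rw [FiniteField.sum_pow_lt_card_sub_one F _ (by omega)] at s1 s2
  constructor
  · simp only [pow_one] at s1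
    linear_combination s1 - hcval
  · linear_combination s2 - (c - (4 * ((1 + -1 / 2 * m) ^ s - 1))) * hcval

theorem choose_mul_choose_eq {s t : ℕ} (h2 : (2 : F) ≠ 0) (hcard : 2 < Fintype.card F - 1) (hs0 : s ≠ 0)
    (hs : ∀ z : F, z ^ s = 1 → z = 1) (ht : Even t) (ht0 : t ≠ 0)
    (hroot : ∀ z : F, z ^ t = 1 → z = 1 ∨ z = -1) (htn : t < Fintype.card F - 1)
    (hinj : ∀ m : F, m ≠ 0 → Function.Injective fun w : Fˣ =>
      ((1 + (w : F)) ^ s - 1) * ((1 + m / w) ^ t - 1))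
    (hsn : s < Fintype.card F - 1) {i : ℕ} (hi0 : i ≠ 0)
    (hi : i < Fintype.card F - 1) :
    (s.choose i * t.choose i : F) = -4 * (-1 / 2) ^ i * s.choose i := by
  have h := coeff_mul_coeff_eq (F := F) (A := (1 + X) ^ s - 1) (B := (1 + X) ^ t - 1) (κ := -4)
    (r := -1 / 2) ((natDegree_one_add_X_pow_sub_one_le s).trans_lt hsn)
    ((natDegree_one_add_X_pow_sub_one_le t).trans_lt (by omega)) (fun m hm => ?_) hi
  · rw [coeff_one_add_X_pow_sub_one _ hi0, coeff_one_add_X_pow_sub_one _ hi0,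
      coeff_one_add_X_pow_sub_one _ (by omega),
      Nat.choose_eq_zero_of_lt (show t < i + (Fintype.card F - 1) by omega), Nat.cast_zero,
      add_zero] at h
    exact h
  · have := (sum_units_eq h2 hcard hs0 hs ht ht0 hroot hm (hinj m hm)).1
    simp only [eval_sub, eval_pow, eval_add, eval_one, eval_X]
    rw [this]
    ring

/-- The second power sum read in coefficients. Since 2t may reach q, a folded term in degree i + q -
1 remains. -/
theorem choose_two_mul_eq {s t : ℕ} (h2 : (2 : F) ≠ 0) (hcard : 2 < Fintype.card F - 1) (hs0 : s ≠ 0)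
    (hs : ∀ z : F, z ^ s = 1 → z = 1) (ht : Even t) (ht0 : t ≠ 0)
    (hroot : ∀ z : F, z ^ t = 1 → z = 1 ∨ z = -1) (htn : t < Fintype.card F - 1)
    (hinj : ∀ m : F, m ≠ 0 → Function.Injective fun w : Fˣ =>
      ((1 + (w : F)) ^ s - 1) * ((1 + m / w) ^ t - 1))
    (hsn : 2 * s < Fintype.card F - 1) {i : ℕ} (hi0 : i ≠ 0)
    (hi : i < Fintype.card F - 1) :
    ((2 * s).choose i - 2 * s.choose i : F) * ((2 * t).choose i - 2 * t.choose i +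
      (2 * t).choose (i + (Fintype.card F - 1))) =
      16 * (-1 / 2) ^ i * ((2 * s).choose i - 2 * s.choose i) := by
  have h := coeff_mul_coeff_eq (F := F) (A := ((1 + X) ^ s - 1) ^ 2) (B := ((1 + X) ^ t - 1) ^ 2)
    (κ := 16) (r := -1 / 2) ((natDegree_sq_one_add_X_pow_sub_one_le s).trans_lt hsn)
    ((natDegree_sq_one_add_X_pow_sub_one_le t).trans_lt (by omega)) (fun m hm => ?_) hi
  · rw [coeff_sq_one_add_X_pow_sub_one _ hi0, coeff_sq_one_add_X_pow_sub_one _ hi0,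
      coeff_sq_one_add_X_pow_sub_one _ (by omega),
      Nat.choose_eq_zero_of_lt (show t < i + (Fintype.card F - 1) by omega), Nat.cast_zero,
      mul_zero, sub_zero] at h
    exact h
  · have := (sum_units_eq h2 hcard hs0 hs ht ht0 hroot hm (hinj m hm)).2
    simp only [eval_sub, eval_pow, eval_add, eval_one, eval_X, ← mul_pow]
    rw [this]

end CoefficientIdentities

/-! ### Base-p digits forced by the binomial identities -/

section Digits

theorem two_mul_cast_choose_two (R : Type*) [CommRing R] (n : ℕ) :
    2 * (n.choose 2 : R) = n * (n - 1) := by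
  induction n with
  | zero => simp
  | succ n ih =>
    rw [Nat.choose_succ_succ', Nat.choose_one_right]
    push_cast
    linear_combination ih

theorem cast_choose_pow_mul (R : Type*) [CommRing R] {p : ℕ} [Fact p.Prime] [CharP R p]
    (a n i : ℕ) : (n.choose (p ^ a * i) : R) = (n / p ^ a).choose i := by
  have hp : 0 < p ^ a := pow_pos (Fact.out : p.Prime).pos a
  rw [cast_choose_eq_mod_pow_mul_div_pow R (p := p) a, Nat.mul_mod_right,
    Nat.mul_div_cancel_left _ hp, Nat.choose_zero_right, Nat.cast_one, one_mul]

theorem cast_choose_pow_mul_add_one (R : Type*) [CommRing R] {p : ℕ} [Fact p.Prime] [CharP R p]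
    {a : ℕ} (ha : a ≠ 0) (n i : ℕ) :
    (n.choose (p ^ a * i + 1) : R) = n * (n / p ^ a).choose i := by
  have hp : 1 < p ^ a := Nat.one_lt_pow ha (Fact.out : p.Prime).one_lt
  have h1 : (p ^ a * i + 1) % p ^ a = 1 := by
    rw [Nat.mul_add_mod, Nat.mod_eq_of_lt hp]
  have h2 : (p ^ a * i + 1) / p ^ a = i := by
    rw [Nat.mul_add_div (by omega), Nat.div_eq_of_lt hp, add_zero]
  have h3 : ((n % p ^ a : ℕ) : R) = n := by
    conv_rhs => rw [← Nat.mod_add_div n (p ^ a)]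
    rw [Nat.cast_add, Nat.cast_mul, Nat.cast_pow, CharP.cast_eq_zero R p, zero_pow ha, zero_mul,
      add_zero]
  rw [cast_choose_eq_mod_pow_mul_div_pow R (p := p) a, h1, h2, Nat.choose_one_right, h3]

theorem neg_half_pow_pow {F : Type*} [Field F] {p : ℕ} [Fact p.Prime] [CharP F p]
    (h2 : (2 : F) ≠ 0) (a : ℕ) : (-1 / 2 : F) ^ p ^ a = -1 / 2 := by
  have hp : Odd p := by
    refine (Fact.out : p.Prime).odd_of_ne_two ?_
    rintro rfl
    exact h2 (by exact_mod_cast CharP.cast_eq_zero F 2)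
  have : (2 : F) ^ p ^ a = 2 := by
    rw [← iterateFrobenius_def, map_ofNat]
  rw [div_pow, (hp.pow).neg_one_pow, this]

/-- Doubling digits that are at most 1 produces no carry when p ≥ 3. -/
theorem two_mul_lt_pow_of_digits {p : ℕ} (hp : 3 ≤ p) {e s : ℕ} (hs : s < p ^ e)
    (hd : ∀ j, s / p ^ j % p ≤ 1) : 2 * s < p ^ e := by
  induction e generalizing s with
  | zero => simp at hs ⊢; omega
  | succ e ih =>
    have h1 := ih (s := s / p) (by rw [Nat.div_lt_iff_lt_mul (by omega), ← pow_succ]; exact hs)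
      fun j => by
        have := hd (j + 1)
        rwa [pow_succ', ← Nat.div_div_eq_div_mul] at this
    have h2 := hd 0
    rw [pow_zero, Nat.div_one] at h2
    have h3 := Nat.mod_add_div s p
    have h4 : p * (2 * (s / p) + 1) ≤ p * p ^ e := Nat.mul_le_mul_left p h1
    have h5 : p * (2 * (s / p) + 1) = 2 * (p * (s / p)) + p := by ring
    rw [pow_succ']
    omega

theorem mod_le_one_of_cast {F : Type*} [Field F] {p : ℕ} [Fact p.Prime] [CharP F p] {u : ℕ}
    (h : (u : F) * (u - 1) = 0) : u % p ≤ 1 := by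
  have hp := (Fact.out : p.Prime).two_le
  rcases mul_eq_zero.1 h with h | h
  · have := Nat.mod_eq_zero_of_dvd ((CharP.cast_eq_zero_iff F p u).1 h)
    omega
  · have h' : (u : F) = (1 : ℕ) := by rw [Nat.cast_one]; linear_combination h
    have := (CharP.natCast_eq_natCast F p).1 h'
    rw [Nat.ModEq, Nat.mod_eq_of_lt (show 1 < p by omega)] at this
    omega

/-- The binomial identities forced by the absence of hexagons leave only the exponent `1`. -/
theorem eq_one_of_choose_identities {F : Type*} [Field F] {p : ℕ} [Fact p.Prime] [CharP F p]
    (h2 : (2 : F) ≠ 0) {e s t : ℕ} (hps : ¬ p ∣ s) (hsn : s < p ^ e - 1)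
    (htn : t < p ^ e - 1) (hcop : s.Coprime (p ^ e - 1))
    (h₁ : ∀ i, i ≠ 0 → i < p ^ e - 1 →
      (s.choose i * t.choose i : F) = -4 * (-1 / 2) ^ i * s.choose i)
    (h₂ : 2 * s < p ^ e - 1 → ∀ i, i ≠ 0 → i < p ^ e - 1 →
      ((2 * s).choose i - 2 * s.choose i : F) * ((2 * t).choose i - 2 * t.choose i +
        (2 * t).choose (i + (p ^ e - 1))) =
        16 * (-1 / 2) ^ i * ((2 * s).choose i - 2 * s.choose i)) : s = 1 := by
  by_contra hs1
  have hpp := (Fact.out : p.Prime)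
  have hp2 : p ≠ 2 := by
    rintro rfl
    exact h2 (by exact_mod_cast CharP.cast_eq_zero F 2)
  have hp3 : 3 ≤ p := by have := hpp.two_le; omega
  have h4 : (4 : F) ≠ 0 := by
    have : (4 : F) = 2 * 2 := by norm_num
    rw [this]; exact mul_ne_zero h2 h2
  have hs0 : s ≠ 0 := by rintro rfl; exact hps (dvd_zero p)
  have hvan : ∀ i, ¬ i < p ^ e - 1 → (s.choose i : F) = 0 := fun i hi => by
    rw [Nat.choose_eq_zero_of_lt (by omega), Nat.cast_zero]
  have h₁' : ∀ i, i ≠ 0 → (s.choose i : F) ≠ 0 → (t.choose i : F) = -4 * (-1 / 2) ^ i := by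
    intro i hi0 hne
    have := h₁ i hi0 (by by_contra hi; exact hne (hvan i hi))
    exact mul_left_cancel₀ hne (by linear_combination this)
  have hpow : ∀ j, 0 < p ^ j := fun j => pow_pos hpp.pos j
  -- wherever `s` has a nonzero digit, `t` has the digit two
  have hv : ∀ j, ((s / p ^ j : ℕ) : F) ≠ 0 → ((t / p ^ j : ℕ) : F) = 2 := by
    intro j hj
    have e1 := cast_choose_pow_mul F (p := p) j s 1
    have e2 := cast_choose_pow_mul F (p := p) j t 1
    rw [mul_one, Nat.choose_one_right] at e1 e2
    rw [← e2, h₁' _ (hpow j).ne' (e1 ▸ hj), neg_half_pow_pow h2]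
    field_simp
    norm_num
  -- Otherwise index 2p^j gives the binomial of t the value -4 · (1/4) = -1, whereas `hv` makes it
  -- C(2,2) = 1.
  have hdig : ∀ j, ((s / p ^ j : ℕ) : F) * ((s / p ^ j : ℕ) - 1) = 0 := by
    intro j
    by_contra hne
    have hu := left_ne_zero_of_mul hne
    have e1 := cast_choose_pow_mul F (p := p) j s 2
    have e2 := cast_choose_pow_mul F (p := p) j t 2
    have e3 := two_mul_cast_choose_two F (s / p ^ j)
    have e4 := two_mul_cast_choose_two F (t / p ^ j)
    have hne' : (s.choose (p ^ j * 2) : F) ≠ 0 := by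
      rw [e1]; intro h0; rw [h0, mul_zero] at e3; exact hne e3.symm
    have e5 := h₁' _ (mul_ne_zero (hpow j).ne' two_ne_zero) hne'
    rw [pow_mul, neg_half_pow_pow h2, e2] at e5
    rw [hv j hu, e5] at e4
    field_simp at e4
    exact mul_ne_zero h4 h2 (by linear_combination -e4)
  have h2s : 2 * s < p ^ e - 1 := by
    have := two_mul_lt_pow_of_digits hp3 (show s < p ^ e by omega)
      fun j => mod_le_one_of_cast (hdig j)
    -- If 2s = p^e - 1, then s divides p^e - 1, and coprimality gives s = 1.
    refine lt_of_le_of_ne (by omega) fun heq => ?_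
    rw [← heq] at hcop
    exact hs1 (hcop.eq_one_of_dvd (Dvd.intro_left 2 rfl))
  have hsF : (s : F) = 1 := by
    have h0 := hdig 0
    rw [pow_zero, Nat.div_one] at h0
    rcases mul_eq_zero.1 h0 with h | h
    · exact absurd ((CharP.cast_eq_zero_iff F p s).1 h) hps
    · linear_combination h
  have htF : (t : F) = 2 := by
    have := hv 0 (by rw [pow_zero, Nat.div_one, hsF]; exact one_ne_zero)
    rwa [pow_zero, Nat.div_one] at this
  have hn2 : 2 < p ^ e - 1 := by omega
  -- the coefficient at `2` bounds `t`
  have ht2 : 2 * t < p ^ e := by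
    by_contra hge
    have e0 : e ≠ 0 := by rintro rfl; simp at hn2
    have key := h₂ h2s 2 two_ne_zero hn2
    have a1 := two_mul_cast_choose_two F s
    have a2 := two_mul_cast_choose_two F (2 * s)
    have a3 := two_mul_cast_choose_two F t
    have a4 := two_mul_cast_choose_two F (2 * t)
    push_cast at a2 a4
    rw [hsF] at a1 a2
    rw [htF] at a3 a4
    -- A carry past p^e makes this folded term 4, so the identity at index 2 reads 4 + 4 = 4.
    have a5 : ((2 * t).choose (2 + (p ^ e - 1)) : F) = 4 := by
      have := cast_choose_pow_mul_add_one F (p := p) e0 (2 * t) 1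
      rw [show p ^ e * 1 + 1 = 2 + (p ^ e - 1) by omega,
        show 2 * t / p ^ e = 1 from Nat.div_eq_of_lt_le (by omega) (by omega)] at this
      rw [this]
      push_cast
      rw [htF]
      norm_num
    rw [a5] at key
    have b1 : ((2 * s).choose 2 - 2 * s.choose 2 : F) = 1 :=
      mul_left_cancel₀ h2 (by linear_combination a2 - 2 * a1)
    have b2 : ((2 * t).choose 2 - 2 * t.choose 2 : F) = 4 :=
      mul_left_cancel₀ h2 (by linear_combination a4 - 2 * a3)
    rw [b1, b2] at key
    field_simp at key
    exact mul_ne_zero h4 h4 (by linear_combination key)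
  -- the coefficient at the two lowest digits of `s`
  obtain ⟨a, r, hr, hsr⟩ := Nat.exists_eq_pow_mul_and_not_dvd (show s - 1 ≠ 0 by omega) p
    hpp.ne_one
  have ha : a ≠ 0 := by
    rintro rfl
    apply hr
    rw [pow_zero, one_mul] at hsr
    rw [← hsr, ← CharP.cast_eq_zero_iff F p, Nat.cast_sub (by omega), hsF, Nat.cast_one, sub_self]
  have hpa : 3 ≤ p ^ a := hp3.trans (Nat.le_self_pow ha p)
  have hr0 : r ≠ 0 := by rintro rfl; exact hr (dvd_zero p)
  have hrF : (r : F) ≠ 0 := fun h => hr ((CharP.cast_eq_zero_iff F p r).1 h)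
  have hle : p ^ a ≤ s - 1 := hsr ▸ Nat.le_mul_of_pos_right _ (Nat.pos_of_ne_zero hr0)
  have hsa : s / p ^ a = r := by
    rw [show s = p ^ a * r + 1 by omega, Nat.mul_add_div (by omega), Nat.div_eq_of_lt (by omega),
      add_zero]
  have h2sa : 2 * s / p ^ a = 2 * r := by
    rw [show 2 * s = p ^ a * (2 * r) + 2 by rw [mul_left_comm, ← hsr]; omega,
      Nat.mul_add_div (by omega), Nat.div_eq_of_lt (by omega), add_zero]
  have hva := hv a (by rw [hsa]; exact hrF)
  -- With d the quotient of 2t by p^a, this index gives 2r(4d - 8) = 4 · 2r, so d = 3 in F. But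
  -- doubling a quotient equal to 2 in F, with or without a carry, gives 4 or 5.
  have key := h₂ h2s (p ^ a * 1 + 1) (by omega) (by omega)
  rw [cast_choose_pow_mul_add_one F ha, cast_choose_pow_mul_add_one F ha,
    cast_choose_pow_mul_add_one F ha, cast_choose_pow_mul_add_one F ha, hsa, h2sa,
    Nat.choose_eq_zero_of_lt (show 2 * t < p ^ a * 1 + 1 + (p ^ e - 1) by omega)] at key
  simp only [Nat.choose_one_right, mul_one, pow_add, pow_one, neg_half_pow_pow h2] at key
  push_cast at key
  rw [hsF, htF, hva] at key
  have hd : ((2 * t / p ^ a : ℕ) : F) = 3 := by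
    field_simp at key
    exact mul_left_cancel₀ (mul_ne_zero h4 h4) (by linear_combination key)
  have hcase : 2 * t / p ^ a = 2 * (t / p ^ a) ∨ 2 * t / p ^ a = 2 * (t / p ^ a) + 1 := by
    have h6 := Nat.div_add_mod t (p ^ a)
    have h7 := Nat.mod_lt t (hpow a)
    have h8 : 2 * t = p ^ a * (2 * (t / p ^ a)) + 2 * (t % p ^ a) := by
      rw [mul_left_comm]; omega
    rw [h8, Nat.mul_add_div (hpow a)]
    rcases lt_or_ge (2 * (t % p ^ a)) (p ^ a) with h9 | h9
    · left
      rw [Nat.div_eq_of_lt h9, add_zero]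
    · right
      have h10 : 2 * (t % p ^ a) / p ^ a = 1 := Nat.div_eq_of_lt_le (by omega) (by omega)
      rw [h10]
  rcases hcase with h | h
  · rw [h, Nat.cast_mul, hva] at hd
    exact one_ne_zero (α := F) (by push_cast at hd; linear_combination hd)
  · rw [h, Nat.cast_add, Nat.cast_mul, hva] at hd
    exact h2 (by push_cast at hd; linear_combination hd)

end Digits

/-! ### Segre's tangent argument -/

section Tangents

variable {F : Type*} [Field F] [Fintype F] [DecidableEq F]

/-- T is the slope missed at a, and r is that of the chord ab. Multiplying slope minus r by the
displacement gives the height above the chord, so Wilson's product relates T - r to a product of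
heights. That product depends only on the chord, so exchanging a and b changes just the sign of b -
a. -/
theorem sub_mul_prod_mul_sub_eq_one {h : F → F} {a b T : F} (hab : a ≠ b)
    (hinj : Function.Injective fun v : Fˣ => (h (a + v) - h a) / v)
    (hT : ∀ v : Fˣ, (h (a + v) - h a) / v ≠ T)
    (hprod : ∀ φ : F → F, (∏ v : Fˣ, φ ((h (a + v) - h a) / v)) * φ T = ∏ x, φ x) {r : F}
    (hr : h b - h a = r * (b - a)) :
    (b - a) * (∏ y, oneAtZero (h y - h a - r * (y - a))) * (T - r) = 1 := by
  have hba : b - a ≠ 0 := sub_ne_zero.2 hab.symm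
  set u : Fˣ := Units.mk0 (b - a) hba
  have hu : (u : F) = b - a := rfl
  have hur : (h (a + u) - h a) / u = r := by
    rw [hu, add_sub_cancel, hr, mul_div_cancel_right₀ _ hba]
  have hTr : T - r ≠ 0 := sub_ne_zero.2 fun e => hT u (by rw [hur, e])
  have hpt : ∀ v : Fˣ, oneAtZero ((h (a + v) - h a) / v - r) * v =
      oneAtZero (h (a + v) - h a - r * ((a + v) - a)) * (if v = u then (v : F) else 1) := by
    intro v
    have hv := v.ne_zero
    have e : h (a + v) - h a - r * ((a + v) - a) = ((h (a + v) - h a) / v - r) * v := by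
      field_simp
      ring
    by_cases hvu : v = u
    · rw [if_pos hvu, e, hvu, hur, sub_self, zero_mul]
    · have : (h (a + v) - h a) / v - r ≠ 0 := fun h0 =>
        hvu (hinj (by simp only; rw [hur]; exact sub_eq_zero.1 h0))
      rw [if_neg hvu, e, oneAtZero_of_ne this, oneAtZero_of_ne (mul_ne_zero this hv), mul_one]
  have e1 := Finset.prod_congr rfl fun v (_ : v ∈ (Finset.univ : Finset Fˣ)) => hpt v
  have e2 := prod_units_mul_zero (F := F)
    fun v => oneAtZero (h (a + v) - h a - r * ((a + v) - a))
  simp only [add_zero, sub_self, mul_zero, oneAtZero_zero, mul_one] at e2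
  have e3 : ∏ x : F, oneAtZero (h (a + x) - h a - r * (a + x - a)) =
      ∏ y : F, oneAtZero (h y - h a - r * (y - a)) :=
    Fintype.prod_equiv (Equiv.addLeft a) _ _ fun _ => rfl
  rw [Finset.prod_mul_distrib, Finset.prod_mul_distrib, prod_units_val, e2, e3,
    Finset.prod_ite_eq', if_pos (Finset.mem_univ _), hu] at e1
  have e4 := hprod fun x => oneAtZero (x - r)
  rw [prod_oneAtZero_sub, oneAtZero_of_ne hTr] at e4
  linear_combination -(T - r) * e1 - e4

/-- A monomial of a field of odd order whose graph is an arc is the square: the tangent argument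
of Segre's theorem. -/
theorem pow_eq_sq_of_injective_slopes (h2 : (2 : F) ≠ 0) {t : ℕ} (ht0 : t ≠ 0)
    (hinj : ∀ b : F, Function.Injective fun v : Fˣ => ((b + v) ^ t - b ^ t) / (v : F)) (y : F) :
    y ^ t = y ^ 2 := by
  choose T hT _ hprod using fun b => exists_missing_value (hinj b)
  have hsum : ∀ a b r : F, a ≠ b → b ^ t - a ^ t = r * (b - a) → T a + T b = 2 * r := by
    intro a b r hab hr
    have e1 := sub_mul_prod_mul_sub_eq_one (h := fun x => x ^ t) hab (hinj a) (hT a) (hprod a) hr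
    have e2 := sub_mul_prod_mul_sub_eq_one (h := fun x => x ^ t) hab.symm (hinj b) (hT b)
      (hprod b) (r := r) (by linear_combination -hr)
    have e3 : (fun y : F => oneAtZero (y ^ t - b ^ t - r * (y - b))) =
        fun y => oneAtZero (y ^ t - a ^ t - r * (y - a)) := by
      funext y
      congr 1
      linear_combination -hr
    rw [e3] at e2
    have hne : (b - a) * ∏ y, oneAtZero (y ^ t - a ^ t - r * (y - a)) ≠ 0 := fun h0 => by
      rw [h0, zero_mul] at e1
      exact zero_ne_one e1
    exact mul_left_cancel₀ hne (by linear_combination e1 - e2)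
  -- The product of all elements of F is zero and the slopes attained at 0 are not, so the missing
  -- one is.
  have hT0 : T 0 = 0 := by
    have := hprod 0 id
    simp only [id, zero_add, zero_pow ht0, sub_zero] at this
    rw [Finset.prod_eq_zero (Finset.mem_univ (0 : F)) rfl] at this
    refine (mul_eq_zero.1 this).resolve_left (Finset.prod_ne_zero_iff.2 fun v _ => ?_)
    exact div_ne_zero (pow_ne_zero _ v.ne_zero) v.ne_zero
  have hTb : ∀ b : F, b ≠ 0 → T b = 2 * (b ^ t / b) := by
    intro b hb
    have := hsum 0 b (b ^ t / b) hb.symm (by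
      rw [zero_pow ht0]
      field_simp
      ring)
    linear_combination this - hT0
  by_cases hy0 : y = 0
  · rw [hy0, zero_pow ht0, zero_pow two_ne_zero]
  by_cases hy1 : y = 1
  · rw [hy1, one_pow, one_pow]
  have hy1' : y - 1 ≠ 0 := sub_ne_zero.2 hy1
  -- The chord from 1 to y gives 1 + y^t/y = (y^t - 1)/(y - 1), which simplifies to y^t = y².
  have key := hsum 1 y ((y ^ t - 1) / (y - 1)) (Ne.symm hy1) (by rw [one_pow]; field_simp)
  rw [hTb 1 one_ne_zero, hTb y hy0, one_pow, div_one, ← mul_add] at key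
  have key := mul_left_cancel₀ h2 key
  field_simp at key
  linear_combination -key

end Tangents

/-! ### Injectivity of the power maps -/

section MonomialReduction

open Function

variable {F : Type*} [Field F]

theorem not_quadrangle_monomial {u v s t : ℕ}
    (h : 8 ≤ (incidenceGraph (F := F) (fun x y => x ^ u * y ^ v)
      (fun x y => x ^ s * y ^ t)).egirth) {x x' y y' : F} (hx : x ≠ x') (hy : y ≠ y')
    (hf : (x ^ u - x' ^ u) * (y ^ v - y' ^ v) = 0)
    (hg : (x ^ s - x' ^ s) * (y ^ t - y' ^ t) = 0) : False :=
  not_quadrangle h hx hy (by linear_combination hf) (by linear_combination hg)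

theorem exists_pow_inverse [Finite F] {u : ℕ} (hu : Injective fun x : F => x ^ u) :
    ∃ u', ∀ x : F, (x ^ u) ^ u' = x := by
  let σ : Equiv.Perm F := Equiv.ofBijective _ (Finite.injective_iff_bijective.1 hu)
  have hσ : ∀ (k : ℕ) (x : F), (σ ^ k) x = x ^ u ^ k := by
    intro k
    induction k with
    | zero => intro x; simp
    | succ k ih =>
      intro x
      rw [pow_succ, Equiv.Perm.mul_apply, ih, pow_succ', pow_mul]
      rfl
  refine ⟨u ^ (orderOf σ - 1), fun x => ?_⟩
  rw [← pow_mul, ← pow_succ', Nat.sub_add_cancel (orderOf_pos σ), ← hσ, pow_orderOf_eq_one,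
    Equiv.Perm.one_apply]

theorem inv_ne_self_of_ne {z : F} (h0 : z ≠ 0) (h1 : z ≠ 1) (hm : z ≠ -1) : z⁻¹ ≠ z := by
  intro h
  have : (z - 1) * (z + 1) = 0 := by
    have e : z⁻¹ * z = 1 := inv_mul_cancel₀ h0
    rw [h] at e
    linear_combination e
  rcases mul_eq_zero.1 this with h | h
  · exact h1 (sub_eq_zero.1 h)
  · exact hm (by linear_combination h)

theorem even_of_not_injective [Finite F] (h2 : (2 : F) ≠ 0) {u v s t : ℕ}
    (h : 8 ≤ (incidenceGraph (F := F) (fun x y => x ^ u * y ^ v)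
      (fun x y => x ^ s * y ^ t)).egirth) (hs : Injective fun x : F => x ^ s)
    (hv : ¬ Injective fun x : F => x ^ v) (hv0 : v ≠ 0) : Even v := by
  have hs0 : s ≠ 0 := by
    rintro rfl
    exact zero_ne_one (hs (show (0 : F) ^ 0 = 1 ^ 0 by simp))
  obtain ⟨z, hz, hz1⟩ : ∃ z : F, z ^ v = 1 ∧ z ≠ 1 := by
    by_contra hcon
    push Not at hcon
    exact hv (pow_injective_of_pow_eq_one hv0 hcon)
  have hz0 : z ≠ 0 := by
    rintro rfl
    rw [zero_pow hv0] at hz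
    exact zero_ne_one hz
  have hquad : ∀ y y' : F, y ≠ y' → y ^ v = 1 → y' ^ v = 1 → y ^ t ≠ y' ^ t := by
    intro y y' hne h1 h1' ht
    exact not_quadrangle_monomial h (zero_ne_one (α := F)) hne
      (by rw [h1, h1', sub_self, mul_zero]) (by rw [ht, sub_self, mul_zero])
  have hzm : z = -1 := by
    by_contra hzm
    have hinv := inv_ne_self_of_ne hz0 hz1 hzm
    have hzv : z⁻¹ ^ v = 1 := by rw [inv_pow, hz, inv_one]
    have hzi1 : z⁻¹ ≠ 1 := fun e => hz1 (inv_eq_one.1 e)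
    have ha1 : z ^ t ≠ 1 := by
      have := hquad z 1 hz1 hz (one_pow v)
      rwa [one_pow] at this
    have ha0 : z ^ t ≠ 0 := pow_ne_zero _ hz0
    obtain ⟨x, hx⟩ := (Finite.injective_iff_surjective.1 hs) (-(z ^ t)⁻¹)
    simp only at hx
    have hx0 : x ≠ 0 := by
      rintro rfl
      rw [zero_pow hs0] at hx
      exact neg_ne_zero.2 (inv_ne_zero ha0) hx.symm
    have hx1 : x ≠ 1 := by
      rintro rfl
      rw [one_pow] at hx
      have hm : z ^ t = -1 := by
        have e : (z ^ t)⁻¹ * z ^ t = 1 := inv_mul_cancel₀ ha0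
        linear_combination z ^ t * hx - e
      exact hquad z⁻¹ z hinv hzv hz (by rw [inv_pow, hm, inv_neg_one])
    refine not_hexagon h (x₁ := x) (x₂ := 1) (x₃ := 0) (y₁ := 1) (y₂ := z⁻¹) (y₃ := z) hx1
      one_ne_zero hx0 hzi1.symm hinv hz1.symm ?_ ?_
    · simp only [one_pow, hz, hzv]
      ring
    · simp only [one_pow, hx, zero_pow hs0, inv_pow]
      field_simp
      ring
  rcases Nat.even_or_odd v with he | ho
  · exact he
  · rw [hzm, ho.neg_one_pow] at hz
    exact absurd (by linear_combination -hz) h2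

theorem injective_or_injective [Finite F] (h2 : (2 : F) ≠ 0) {u v s t : ℕ}
    (h : 8 ≤ (incidenceGraph (F := F) (fun x y => x ^ u * y ^ v)
      (fun x y => x ^ s * y ^ t)).egirth)
    (hu : Injective fun x : F => x ^ u) (hs : Injective fun x : F => x ^ s) :
    (Injective fun x : F => x ^ v) ∨ Injective fun x : F => x ^ t := by
  by_contra hcon
  rw [not_or] at hcon
  obtain ⟨hv, ht⟩ := hcon
  have hquad : ∀ y y' : F, y ≠ y' → y ^ v = y' ^ v → y ^ t ≠ y' ^ t := by
    intro y y' hne h1 ht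
    exact not_quadrangle_monomial h (zero_ne_one (α := F)) hne
      (by rw [h1, sub_self, mul_zero]) (by rw [ht, sub_self, mul_zero])
  have hv0 : v ≠ 0 := by
    rintro rfl
    refine ht fun y y' he => ?_
    by_contra hne
    exact hquad y y' hne (by simp) he
  have ht0 : t ≠ 0 := by
    rintro rfl
    refine hv fun y y' he => ?_
    by_contra hne
    exact hquad y y' hne he (by simp)
  have hev := even_of_not_injective h2 h hs hv hv0
  have het := even_of_not_injective h2
    (by rwa [(incidenceGraphSwap _ _).egirth_eq] at h) hu ht ht0
  -- Both exponents are even, so y = 1 and y = -1 collide in both monomials.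
  refine hquad 1 (-1) (fun e => h2 (by linear_combination e)) ?_ ?_
  · rw [one_pow, hev.neg_one_pow]
  · rw [one_pow, het.neg_one_pow]

end MonomialReduction

/-! ### Parities and roots of unity when the first function is xy -/

section Parity

variable {F : Type*} [Field F] {s t : ℕ}

/-- At most two roots of unity when the corresponding factors of the products vanish. -/
theorem eq_one_or_eq_neg_one_of_vanishing {k : ℕ} (hk : k ≠ 0)
    (hinj : ∀ z z' : F, z ≠ 1 → z' ≠ 1 → z ^ k = 1 → z' ^ k = 1 → z = z') (z : F)
    (hz : z ^ k = 1) : z = 1 ∨ z = -1 := by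
  by_contra hcon
  rw [not_or] at hcon
  have hz0 : z ≠ 0 := by
    rintro rfl
    rw [zero_pow hk] at hz
    exact zero_ne_one hz
  exact inv_ne_self_of_ne hz0 hcon.1 hcon.2 (hinj _ _ (fun e => hcon.1 (inv_eq_one.1 e)) hcon.1
    (by rw [inv_pow, hz, inv_one]) hz)

/-- At base point (1, 0), every w = z - 1 with z a root of unity of exponent s gives the product
zero, which injectivity allows at most once. -/
theorem eq_of_pow_left_eq_one
    (h : 8 ≤ (incidenceGraph (F := F) (fun x y => x * y) (fun x y => x ^ s * y ^ t)).egirth)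
    {z z' : F} (h1 : z ≠ 1) (h1' : z' ≠ 1) (hz : z ^ s = 1)
    (hz' : z' ^ s = 1) : z = z' := by
  have := injOn_of_eight_le_egirth h 1 0 one_ne_zero (w := z - 1) (w' := z' - 1)
    (sub_ne_zero.2 h1) (sub_ne_zero.2 h1') (by simp [hz, hz'])
  linear_combination this

theorem eq_of_pow_right_eq_one
    (h : 8 ≤ (incidenceGraph (F := F) (fun x y => x * y) (fun x y => x ^ s * y ^ t)).egirth)
    {z z' : F} (h1 : z ≠ 1) (h1' : z' ≠ 1) (hz : z ^ t = 1)
    (hz' : z' ^ t = 1) : z = z' := by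
  have := injOn_of_eight_le_egirth h 0 1 one_ne_zero (w := (z - 1)⁻¹) (w' := (z' - 1)⁻¹)
    (inv_ne_zero (sub_ne_zero.2 h1)) (inv_ne_zero (sub_ne_zero.2 h1')) (by simp [hz, hz'])
  linear_combination inv_inj.1 this

/-- Injectivity at base point (0, 0) with m = 1, tested on w = -1 and w = 1. The powers of 0 are
kept so that zero exponents are covered. -/
theorem neg_one_pow_mul_neg_one_pow_ne
    (h : 8 ≤ (incidenceGraph (F := F) (fun x y => x * y) (fun x y => x ^ s * y ^ t)).egirth)
    (h2 : (2 : F) ≠ 0) :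
    ((-1) ^ s - 0 ^ s : F) * ((-1) ^ t - 0 ^ t) ≠ (1 - 0 ^ s) * (1 - 0 ^ t) := by
  intro e
  have := injOn_of_eight_le_egirth h 0 0 one_ne_zero (w := -1) (w' := 1)
    (neg_ne_zero.2 one_ne_zero) one_ne_zero (by simpa using e)
  exact h2 (by linear_combination -this)

theorem odd_or_odd
    (h : 8 ≤ (incidenceGraph (F := F) (fun x y => x * y) (fun x y => x ^ s * y ^ t)).egirth)
    (h2 : (2 : F) ≠ 0) : Odd s ∨ Odd t := by
  by_contra hcon
  rw [not_or, Nat.not_odd_iff_even, Nat.not_odd_iff_even] at hcon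
  exact neg_one_pow_mul_neg_one_pow_ne h h2
    (by rw [hcon.1.neg_one_pow, hcon.2.neg_one_pow])

theorem right_ne_zero
    (h : 8 ≤ (incidenceGraph (F := F) (fun x y => x * y) (fun x y => x ^ s * y ^ t)).egirth)
    (h2 : (2 : F) ≠ 0) : t ≠ 0 := by
  rintro rfl
  exact neg_one_pow_mul_neg_one_pow_ne h h2 (by simp)

theorem even_right
    (h : 8 ≤ (incidenceGraph (F := F) (fun x y => x * y) (fun x y => x ^ s * y ^ t)).egirth)
    (h2 : (2 : F) ≠ 0) (hs : Odd s) : Even t := by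
  by_contra ht
  rw [Nat.not_even_iff_odd] at ht
  exact neg_one_pow_mul_neg_one_pow_ne h h2 (by
    rw [hs.neg_one_pow, ht.neg_one_pow, zero_pow hs.pos.ne', zero_pow ht.pos.ne']; ring)

theorem eq_one_of_pow_left
    (h : 8 ≤ (incidenceGraph (F := F) (fun x y => x * y) (fun x y => x ^ s * y ^ t)).egirth)
    (h2 : (2 : F) ≠ 0) (hs : Odd s) (z : F) (hz : z ^ s = 1) : z = 1 := by
  rcases eq_one_or_eq_neg_one_of_vanishing hs.pos.ne'
    (fun z z' a b c d => eq_of_pow_left_eq_one h a b c d) z hz with e | e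
  · exact e
  · rw [e, hs.neg_one_pow] at hz
    exact absurd (by linear_combination -hz) h2

end Parity

/-! ### Exponent reductions and the final isomorphism -/

section Classification

open Function

variable {F : Type*} [Field F]

theorem exists_pow_eq_of_ne_zero [Fintype F] {k : ℕ} (hk : k ≠ 0) :
    ∃ k' ≠ 0, k' ≤ Fintype.card F - 1 ∧ k' ≡ k [MOD Fintype.card F - 1] ∧
      ∀ x : F, x ^ k' = x ^ k := by
  set n := Fintype.card F - 1 with hn
  have hn0 : 0 < n := by have := Fintype.one_lt_card (α := F); omega
  have hk' : (k - 1) % n + 1 + n * ((k - 1) / n) = k := by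
    have := Nat.mod_add_div (k - 1) n
    omega
  -- The representative lies in 1, …, n rather than 0, …, n - 1, so that powers of 0 are preserved.
  refine ⟨(k - 1) % n + 1, by omega, Nat.mod_lt _ hn0, ?_, fun x => ?_⟩
  · conv_rhs => rw [← hk']
    exact (Nat.add_mul_mod_self_left _ _ _).symm
  · by_cases hx : x = 0
    · rw [hx, zero_pow hk, zero_pow (by omega)]
    · conv_rhs => rw [← hk', pow_add, pow_mul, FiniteField.pow_card_sub_one_eq_one x hx, one_pow,
        mul_one]

theorem coprime_card_sub_one [Fintype F] {s : ℕ} (hs : ∀ z : F, z ^ s = 1 → z = 1) :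
    s.Coprime (Fintype.card F - 1) := by
  classical
  refine Nat.coprime_of_dvd fun l hl hls hln => ?_
  rw [← Fintype.card_units] at hln
  have := Fact.mk hl
  obtain ⟨z, hz⟩ := exists_prime_orderOf_dvd_card l hln
  have h1 : z ^ s = 1 := orderOf_dvd_iff_pow_eq_one.1 (hz ▸ hls)
  have h2 : z = 1 := Units.ext (hs z (by rw [← Units.val_pow_eq_pow_val, h1, Units.val_one]))
  rw [h2, orderOf_one] at hz
  exact hl.ne_one hz.symm

theorem card_sub_one_le_two [Fintype F] (h : ∀ z : F, z ≠ 0 → z = 1 ∨ z = -1) :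
    Fintype.card F - 1 ≤ 2 := by
  refine Nat.le_of_dvd two_pos ((FiniteField.forall_pow_eq_one_iff F 2).1 fun x => ?_)
  refine Units.ext ?_
  rcases h x x.ne_zero with h | h <;> simp [h]

theorem nonempty_iso_of_not_dvd [Fintype F] (h2 : (2 : F) ≠ 0) {p e : ℕ} [Fact p.Prime]
    [CharP F p] (hcard : Fintype.card F = p ^ e) {s t : ℕ} (hs : Odd s) (hps : ¬ p ∣ s)
    (hsn : s < Fintype.card F - 1 ∨ s = 1)
    (h : 8 ≤ (incidenceGraph (F := F) (fun x y => x * y) (fun x y => x ^ s * y ^ t)).egirth) :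
    Nonempty (incidenceGraph (F := F) (fun x y => x * y) (fun x y => x ^ s * y ^ t) ≃g
      incidenceGraph (F := F) (fun x y => x * y) (fun x y => x * y ^ 2)) := by
  classical
  obtain ⟨t', ht'0, htn, -, htt⟩ := exists_pow_eq_of_ne_zero (F := F) (right_ne_zero h h2)
  simp only [← htt] at h ⊢
  clear htt
  have ht := even_right h h2 hs
  have hs' := eq_one_of_pow_left h h2 hs
  have hroot := eq_one_or_eq_neg_one_of_vanishing ht'0
    (fun z z' a b c d => eq_of_pow_right_eq_one h a b c d)
  have hs1 : s = 1 := by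
    by_contra hs1
    have hsn := hsn.resolve_right hs1
    have hn : 2 < Fintype.card F - 1 := by
      have := hs.pos
      rcases hs with ⟨k, rfl⟩
      omega
    have htn : t' < Fintype.card F - 1 := by
      -- If t' were q - 1, every unit would be a root of unity of exponent t', hence ±1, against q -
      -- 1 > 2.
      refine lt_of_le_of_ne htn fun he => ?_
      refine hn.not_ge (card_sub_one_le_two fun z hz => hroot z ?_)
      rw [he, FiniteField.pow_card_sub_one_eq_one z hz]
    have hinj : ∀ m : F, m ≠ 0 → Injective fun w : Fˣ =>
        ((1 + (w : F)) ^ s - 1) * ((1 + m / w) ^ t' - 1) := fun m hm w w' he =>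
      Units.ext (injOn_of_eight_le_egirth h 1 1 hm w.ne_zero w'.ne_zero
        (by simpa only [one_pow] using he))
    refine hs1 (eq_one_of_choose_identities (F := F) (p := p) (e := e) (t := t') h2 hps
      (hcard ▸ hsn) (hcard ▸ htn) (hcard ▸ coprime_card_sub_one hs') ?_ ?_)
    · rw [← hcard]
      intro i hi0 hi
      exact choose_mul_choose_eq h2 hn hs.pos.ne' hs' ht ht'0 hroot htn hinj hsn hi0 hi
    · rw [← hcard]
      intro h2s i hi0 hi
      exact choose_two_mul_eq h2 hn hs.pos.ne' hs' ht ht'0 hroot htn hinj h2s hi0 hi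
  subst hs1
  have hsq := pow_eq_sq_of_injective_slopes h2 ht'0 fun b v v' he => by
    have := injOn_of_eight_le_egirth h 0 b one_ne_zero (inv_ne_zero v.ne_zero)
      (inv_ne_zero v'.ne_zero) (by
        simp only [div_eq_mul_inv] at he
        simp only [pow_one, zero_add, sub_zero, one_div, inv_inv]
        linear_combination he)
    exact Units.ext (inv_inj.1 this)
  simp only [hsq, pow_one]
  exact ⟨RelIso.refl _⟩

theorem nonempty_iso_of_odd [Fintype F] (h2 : (2 : F) ≠ 0) (hodd : Odd (Fintype.card F))
    {s t : ℕ} (hs : Odd s)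
    (h : 8 ≤ (incidenceGraph (F := F) (fun x y => x * y) (fun x y => x ^ s * y ^ t)).egirth) :
    Nonempty (incidenceGraph (F := F) (fun x y => x * y) (fun x y => x ^ s * y ^ t) ≃g
      incidenceGraph (F := F) (fun x y => x * y) (fun x y => x * y ^ 2)) := by
  obtain ⟨p, hchar, e, hp, hcard⟩ := FiniteField.card' F
  have := Fact.mk hp
  have hevn : Even (Fintype.card F - 1) := Nat.Odd.sub_odd hodd odd_one
  obtain ⟨s', hs'0, hs'n, hmod, hss⟩ := exists_pow_eq_of_ne_zero (F := F) hs.pos.ne'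
  have hs' : Odd s' := by
    have := hmod.of_dvd hevn.two_dvd
    rw [Nat.odd_iff] at hs ⊢
    rw [← hs]; exact this
  simp only [← hss] at h ⊢
  have hs'n : s' < Fintype.card F - 1 := by
    refine lt_of_le_of_ne hs'n fun he => ?_
    rw [he] at hs'
    exact (Nat.not_even_iff_odd.2 hs') hevn
  obtain ⟨b, s₁, hps, rfl⟩ := Nat.exists_eq_pow_mul_and_not_dvd hs'0 p hp.ne_one
  have hq : ∀ y : F, y ^ (p ^ (e : ℕ)) ^ b = y := fun y => by
    rw [← hcard]; exact FiniteField.pow_card_pow b y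
  -- The p^b-th power map strips p^b from the exponent of x; on y it is undone by an extra exponent
  -- p^((e-1)b), since q^b-th powers are trivial on F.
  have hexp : ((p : ℕ) ^ (e : ℕ)) ^ b = p ^ (((e : ℕ) - 1) * b) * p ^ b := by
    rw [← pow_mul, ← pow_add, ← Nat.succ_mul, Nat.succ_eq_add_one, Nat.sub_add_cancel e.pos]
  let iso : incidenceGraph (F := F) (fun x y => x * y)
      (fun x y => x ^ s₁ * y ^ (t * p ^ (((e : ℕ) - 1) * b))) ≃g
      incidenceGraph (F := F) (fun x y => x * y) (fun x y => x ^ (p ^ b * s₁) * y ^ t) :=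
    incidenceGraphCongr (Equiv.refl F) (Equiv.refl F) (AddEquiv.refl F)
      (iterateFrobeniusEquiv F p b).toAddEquiv (fun _ _ => rfl) fun x y => by
        change x ^ (p ^ b * s₁) * y ^ t = iterateFrobeniusEquiv F p b _
        rw [iterateFrobeniusEquiv_def, mul_pow, ← pow_mul, ← pow_mul, mul_comm s₁, mul_assoc t,
          ← hexp, mul_comm t, pow_mul y, hq]
  have hle : s₁ ≤ p ^ b * s₁ := Nat.le_mul_of_pos_left _ (pow_pos hp.pos b)
  obtain ⟨iso'⟩ := nonempty_iso_of_not_dvd h2 hcard (Nat.odd_mul.1 hs').2 hps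
    (Or.inl (hle.trans_lt hs'n)) (by rwa [iso.egirth_eq])
  exact ⟨iso.symm.trans iso'⟩

theorem nonempty_iso_of_mul_left [Fintype F] (h2 : (2 : F) ≠ 0) (hodd : Odd (Fintype.card F))
    {s t : ℕ}
    (h : 8 ≤ (incidenceGraph (F := F) (fun x y => x * y) (fun x y => x ^ s * y ^ t)).egirth) :
    Nonempty (incidenceGraph (F := F) (fun x y => x * y) (fun x y => x ^ s * y ^ t) ≃g
      incidenceGraph (F := F) (fun x y => x * y) (fun x y => x * y ^ 2)) := by
  rcases odd_or_odd h h2 with hs | ht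
  · exact nonempty_iso_of_odd h2 hodd hs h
  · have e₁ : (fun x y : F => y * x) = fun x y => x * y := by funext x y; ring
    have e₂ : (fun x y : F => y ^ s * x ^ t) = fun x y => x ^ t * y ^ s := by funext x y; ring
    have iso : incidenceGraph (F := F) (fun x y => x * y) (fun x y => x ^ s * y ^ t) ≃g
        incidenceGraph (fun x y => y * x) (fun x y => y ^ s * x ^ t) :=
      incidenceGraphTranspose _ _
    rw [e₁, e₂] at iso
    obtain ⟨iso'⟩ := nonempty_iso_of_odd h2 hodd ht (by rwa [← iso.egirth_eq])
    exact ⟨iso.trans iso'⟩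

theorem nonempty_iso_of_injective [Fintype F] (h2 : (2 : F) ≠ 0) (hodd : Odd (Fintype.card F))
    {u v s t : ℕ} (hu : Injective fun x : F => x ^ u) (hv : Injective fun x : F => x ^ v)
    (h : 8 ≤ (incidenceGraph (F := F) (fun x y => x ^ u * y ^ v)
      (fun x y => x ^ s * y ^ t)).egirth) :
    Nonempty (incidenceGraph (F := F) (fun x y => x ^ u * y ^ v) (fun x y => x ^ s * y ^ t) ≃g
      incidenceGraph (F := F) (fun x y => x * y) (fun x y => x * y ^ 2)) := by
  obtain ⟨u', hu'⟩ := exists_pow_inverse hu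
  obtain ⟨v', hv'⟩ := exists_pow_inverse hv
  let iso : incidenceGraph (F := F) (fun x y => x ^ u * y ^ v) (fun x y => x ^ s * y ^ t) ≃g
      incidenceGraph (F := F) (fun x y => x * y) (fun x y => x ^ (u' * s) * y ^ (v' * t)) :=
    incidenceGraphCongr (Equiv.ofBijective _ (Finite.injective_iff_bijective.1 hu))
      (Equiv.ofBijective _ (Finite.injective_iff_bijective.1 hv)) (AddEquiv.refl F)
      (AddEquiv.refl F) (fun _ _ => rfl) fun x y => by
        simp only [Equiv.ofBijective_apply, pow_mul, hu', hv', AddEquiv.refl_apply]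
  obtain ⟨iso'⟩ := nonempty_iso_of_mul_left h2 hodd (by rwa [← iso.egirth_eq])
  exact ⟨iso.trans iso'⟩

theorem nonempty_iso_of_monomials [Fintype F] (h2 : (2 : F) ≠ 0) (hodd : Odd (Fintype.card F))
    {u v s t : ℕ}
    (h : 8 ≤ (incidenceGraph (F := F) (fun x y => x ^ u * y ^ v)
      (fun x y => x ^ s * y ^ t)).egirth) :
    Nonempty (incidenceGraph (F := F) (fun x y => x ^ u * y ^ v) (fun x y => x ^ s * y ^ t) ≃g
      incidenceGraph (F := F) (fun x y => x * y) (fun x y => x * y ^ 2)) := by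
  have hcross : ∀ {k l : ℕ}, (∀ x x' y y' : F, x ≠ x' → y ≠ y' → x ^ k = x' ^ k →
      y ^ l = y' ^ l → False) → (Injective fun x : F => x ^ k) ∨ Injective fun x : F => x ^ l := by
    intro k l hkl
    by_contra hcon
    rw [not_or, not_injective_iff, not_injective_iff] at hcon
    obtain ⟨⟨x, x', hx, hxne⟩, y, y', hy, hyne⟩ := hcon
    exact hkl x x' y y' hxne hyne hx hy
  have hut : (Injective fun x : F => x ^ u) ∨ Injective fun x : F => x ^ t :=
    hcross fun x x' y y' hx hy e e' => not_quadrangle_monomial h hx hy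
      (by rw [e, sub_self, zero_mul]) (by rw [e', sub_self, mul_zero])
  have hsv : (Injective fun x : F => x ^ s) ∨ Injective fun x : F => x ^ v :=
    hcross fun x x' y y' hx hy e e' => not_quadrangle_monomial h hx hy
      (by rw [e', sub_self, mul_zero]) (by rw [e, sub_self, zero_mul])
  have hswap : (Injective fun x : F => x ^ s) → (Injective fun x : F => x ^ t) →
      Nonempty (incidenceGraph (F := F) (fun x y => x ^ u * y ^ v) (fun x y => x ^ s * y ^ t) ≃g
        incidenceGraph (F := F) (fun x y => x * y) (fun x y => x * y ^ 2)) := fun hs ht => by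
    have iso := incidenceGraphSwap (F := F) (fun x y => x ^ u * y ^ v) (fun x y => x ^ s * y ^ t)
    obtain ⟨iso'⟩ := nonempty_iso_of_injective h2 hodd hs ht (by rwa [← iso.egirth_eq])
    exact ⟨iso.trans iso'⟩
  -- Only the cases where the two injective maps share a variable need the hexagon argument.
  rcases hut with hu | ht <;> rcases hsv with hs | hv
  · rcases injective_or_injective h2 h hu hs with hv | ht
    · exact nonempty_iso_of_injective h2 hodd hu hv h
    · exact hswap hs ht
  · exact nonempty_iso_of_injective h2 hodd hu hv h
  · exact hswap hs ht
  · have iso := incidenceGraphTranspose (F := F) (fun x y => x ^ u * y ^ v)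
      (fun x y => x ^ s * y ^ t)
    have h' := h
    rw [iso.egirth_eq] at h'
    simp only [mul_comm (_ ^ u : F), mul_comm (_ ^ s : F)] at h'
    rcases injective_or_injective h2 h' hv ht with hu | hs
    · exact nonempty_iso_of_injective h2 hodd hu hv h
    · exact hswap hs ht

end Classification

theorem theorem6p2 {F : Type*} [Field F] [Finite F] (hq : Odd (Nat.card F))
    (f g : MvPolynomial (Fin 2) F) (hf : IsMonomialPoly f) (hg : IsMonomialPoly g)
    (hgirth : (polyGraph f g).girth = 8) :
    Nonempty (polyGraph f g ≃g gammaThree F) := by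
  have := Fintype.ofFinite F
  rw [Nat.card_eq_fintype_card] at hq
  have h2 : (2 : F) ≠ 0 := by
    intro h
    have hcast := FiniteField.cast_card_eq_zero F
    obtain ⟨k, hk⟩ := hq
    rw [hk] at hcast
    push_cast at hcast
    rw [h] at hcast
    simp at hcast
  obtain ⟨a, u, v, ha, rfl⟩ := hf
  obtain ⟨b, s, t, hb, rfl⟩ := hg
  have h8 : 8 ≤ (polyGraph (MvPolynomial.C a * MvPolynomial.X 0 ^ u * MvPolynomial.X 1 ^ v)
      (MvPolynomial.C b * MvPolynomial.X 0 ^ s * MvPolynomial.X 1 ^ t)).egirth := by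
    rw [SimpleGraph.girth] at hgirth
    -- An acyclic graph has `girth` 0 by convention, so the value 8 is the true `egirth`.
    rw [(ENat.toNat_eq_iff (by norm_num)).1 hgirth]
    rfl
  rw [gammaThree, polyGraph_eq_incidenceGraph, polyGraph_eq_incidenceGraph]
  rw [polyGraph_eq_incidenceGraph] at h8
  simp only [map_mul, map_pow, MvPolynomial.eval_C, MvPolynomial.eval_X, Matrix.cons_val_zero,
    Matrix.cons_val_one] at h8 ⊢
  let iso : incidenceGraph (F := F) (fun x y => x ^ u * y ^ v) (fun x y => x ^ s * y ^ t) ≃g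
      incidenceGraph (F := F) (fun x y => a * x ^ u * y ^ v) (fun x y => b * x ^ s * y ^ t) :=
    incidenceGraphCongr (Equiv.refl F) (Equiv.refl F)
      (DistribMulAction.toAddEquiv F (Units.mk0 a ha)) (DistribMulAction.toAddEquiv F (Units.mk0 b hb))
      (fun x y => mul_assoc _ _ _) (fun x y => mul_assoc _ _ _)
  obtain ⟨iso'⟩ := nonempty_iso_of_monomials h2 hq (by rwa [iso.egirth_eq])
  exact ⟨iso.symm.trans iso'⟩
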